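/- Let $L_x,L_y$ be natural numbers. The $L_x\times L_y$ Lieb lattice with open boundary and dangling bonds has a $d$-site at each vertex $R=(x,y)$, $1\le x\le L_x$, $1\le y\le L_y$, and a $p$-site on each bond: the $x$-bonds $(x+\tfrac12,y)$ with $0\le x\le L_x$, $1\le y\le L_y$, and the $y$-bonds $(x,y+\tfrac12)$ with $1\le x\le L_x$, $0\le y\le L_y$. Thus every row contains $L_x+1$ $x$-bonds and every column contains $L_y+1$ $y$-bonds. A configuration of $N$ distinguishable (Boltzmannian) electrons is a tuple $(r_1,\dots,r_N)$ of pairwise distinct sites (no double occupancy) such that every $d$-site is occupied. Let $X(y)$ be the number of electrons on the $x$-bonds of row $y$, and $Y(x)$ the number of electrons on the $y$-bonds of column $x$. Consider the dynamics generated by the individual terms of the Hamiltonian $$T=-t\sum_{R}\sum_{\delta=x,y}\sum_{\sigma,\sigma'=\uparrow,\downarrow}\Big(d^\dagger_{R,\sigma}\,p^\dagger_{R+\hat\delta/2,\sigma'}\,d_{R,\sigma'}\,p_{R-\hat\delta/2,\sigma}+\mathrm{H.c.}\Big)+[U=\infty].$$ That is, a single move consists of choosing a vertex $R$, a direction $\delta\in\{x,y\}$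 and a sign $\pm$ such that $R\mp\hat\delta/2$ is occupied and $R\pm\hat\delta/2$ is empty, and then simultaneously moving the electron at $R\mp\hat\delta/2$ to $R$ and the electron at $R$ to $R\pm\hat\delta/2$, all other electrons staying in place. A permutation $\pi\in S_N$ is *induced* at $(r_i)$ if $(r_{\pi(i)})$ can be reached from $(r_i)$ by a finite (possibly empty) sequence of moves. **Proposition (even-permutation ergodicity, open boundary).** Let $(r_i)$ be a configuration with $0<X(y)<L_x$ for every row $y$ and $0<Y(x)<L_y$ for every column $x$; equivalently, each row and each column contains at least one $p$-electron and at least two empty bond sites. Then the dynamics is even-permutation-ergodic for $(r_i)$: every even permutation $\pi\in S_N$ is induced at $(r_i)$, and no odd permutation is. -/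

import Mathlib

/-!
The `Lx × Ly` Lieb lattice with open boundary and dangling bonds, distinguishable ("Boltzmannian")
electrons on it, and the dynamics generated by the individual terms of the correlated-hopping
Hamiltonian
`T = -t ∑_{R, δ, σ, σ'} (d†_{R,σ} p†_{R+δ/2,σ'} d_{R,σ'} p_{R-δ/2,σ} + H.c.) + [U = ∞]`.
-/

namespace LiebLattice

/-- Sites (orbitals) of the `Lx × Ly` Lieb lattice with open boundary and dangling bonds.
Indices start at `0`, so the vertex in column `x` and row `y` is `d x y`. The `Lx + 1` bonds of a row
are numbered from left to right, those of a column from bottom to top; the first and the last one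
are the dangling bonds. -/
inductive Site (Lx Ly : ℕ) : Type
  /-- the `d` orbital on the vertex in column `x`, row `y` -/
  | d (x : Fin Lx) (y : Fin Ly)
  /-- the `p` orbital on the `i`-th `x`-bond of row `y` -/
  | px (i : Fin (Lx + 1)) (y : Fin Ly)
  /-- the `p` orbital on the `j`-th `y`-bond of column `x` -/
  | py (x : Fin Lx) (j : Fin (Ly + 1))

/-- The two lattice directions `δ = x, y`. -/
inductive Direction : Type
  | x
  | y

/-- The bond `R - δ/2` for the vertex `R = (x, y)`. -/
def bondBefore {Lx Ly : ℕ} (x : Fin Lx) (y : Fin Ly) : Direction → Site Lx Ly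
  | .x => .px x.castSucc y
  | .y => .py x y.castSucc

/-- The bond `R + δ/2` for the vertex `R = (x, y)`. -/
def bondAfter {Lx Ly : ℕ} (x : Fin Lx) (y : Fin Ly) : Direction → Site Lx Ly
  | .x => .px x.succ y
  | .y => .py x y.succ

/-- A configuration `(r_1, …, r_N)` of `N` distinguishable electrons: no orbital is doubly occupied
(`U = ∞`), and every `d` orbital is occupied. -/
structure Config (Lx Ly N : ℕ) : Type where
  /-- the position of each electron -/
  pos : Fin N → Site Lx Ly
  pos_injective : Function.Injective pos
  d_occupied : ∀ x y, ∃ k, pos k = Site.d x y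

namespace Config

variable {Lx Ly N : ℕ}

/-- `X(y)`: the number of electrons on the `x`-bonds of row `y`. -/
noncomputable def X (r : Config Lx Ly N) (y : Fin Ly) : ℕ :=
  {k : Fin N | ∃ i, r.pos k = Site.px i y}.ncard

/-- `Y(x)`: the number of electrons on the `y`-bonds of column `x`. -/
noncomputable def Y (r : Config Lx Ly N) (x : Fin Lx) : ℕ :=
  {k : Fin N | ∃ j, r.pos k = Site.py x j}.ncard

/-- The permuted configuration `(r_{π(1)}, …, r_{π(N)})`. -/
def permute (r : Config Lx Ly N) (π : Equiv.Perm (Fin N)) : Config Lx Ly N where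
  pos := r.pos ∘ π
  pos_injective := r.pos_injective.comp π.injective
  d_occupied := fun x y => by
    obtain ⟨k, hk⟩ := r.d_occupied x y
    exact ⟨π.symm k, by simpa using hk⟩

/-- Two-electron correlated hopping `a → b → c`: the electron `k` on `a` moves to `b`, while the
electron `l` on `b` moves to the empty site `c`; all other electrons stay. -/
def Hop (a b c : Site Lx Ly) (r r' : Config Lx Ly N) : Prop :=
  ∃ k l : Fin N,
    r.pos k = a ∧ r.pos l = b ∧ (∀ m, r.pos m ≠ c) ∧
    r'.pos k = b ∧ r'.pos l = c ∧ ∀ m, m ≠ k → m ≠ l → r'.pos m = r.pos m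

/-- `r'` arises from `r` by one application of a single term of the Hamiltonian: the term
`d†_{R,σ} p†_{R+δ/2,σ'} d_{R,σ'} p_{R-δ/2,σ}` (first alternative) or its Hermitian conjugate (second
alternative), for some vertex `R` and direction `δ`. -/
def Step (r r' : Config Lx Ly N) : Prop :=
  ∃ (x : Fin Lx) (y : Fin Ly) (δ : Direction),
    Hop (bondBefore x y δ) (.d x y) (bondAfter x y δ) r r' ∨
    Hop (bondAfter x y δ) (.d x y) (bondBefore x y δ) r r'

/-- The permutation `π` is induced at `r` by the dynamics: `(r_i)` is connected to `(r_{π(i)})` by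
repeated applications of terms of the Hamiltonian. -/
def Induces (r : Config Lx Ly N) (π : Equiv.Perm (Fin N)) : Prop :=
  Relation.ReflTransGen Step r (r.permute π)

/-- The dynamics is even-permutation-ergodic for `r`: every even permutation of the electrons is
induced, and no odd one is. -/
def EvenPermutationErgodic (r : Config Lx Ly N) : Prop :=
  ∀ π : Equiv.Perm (Fin N),
    (Equiv.Perm.sign π = 1 → r.Induces π) ∧ (Equiv.Perm.sign π = -1 → ¬ r.Induces π)

end Config

end LiebLattice

/-!
A move along a row or a column takes the electron on a bond onto the adjacent vertex and pushes the
electron there onto the next bond.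

*Odd permutations are not induced.* Order the sites so that the bonds of each line are consecutive.
A hop is the passage of an electron to a neighbouring bond, which does not change the order of the
electrons, followed by an exchange of two electrons. Hence the sign of the permutation sorting the
electrons, times the parity of the sum of all bond indices, is conserved (`parity_eq_of_step`).
Relabelling by `π` multiplies it by the sign of `π`.

*Even permutations are induced.* Moves are reversible and commute with relabelling, so the induced
permutations form a group. If a vertex has an occupied and an empty bond in both directions, then
the commutator of the two hops over it is a three-cycle (`linked_of_crossing`). Call two electrons
linked when a chain of induced three-cycles connects them. On the level of occupation numbers, moves
along a line permute its bonds arbitrarily (`exists_lineReach_occ`). Since every line has an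
occupied and an empty bond, any two electrons that hop together are therefore linked
(`linked_of_hop`), and the electron on a given vertex changes only within its class
(`linked_of_reach_vertex`). As there are two empty bonds on every line, one occupied bond can be
carried over two consecutive vertices, which links the electrons on them (`linked_of_adjacent`);
thus all electrons on vertices are linked. An electron on a bond is linked to them as soon as it
moves, which it must do when that bond is emptied (`linked_vertex`). Finally, a permutation group
whose three-cycles connect all points is primitive and so contains the alternating group, by Jordan's
theorem (`alternatingGroup_le_of_connected`).
-/

/-! ### Subgroups connected by three-cycles -/

namespace LiebLattice

open Equiv

/-- Two points are linked by `G` when some three-cycle in `G` moves both of them. -/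
def ThreeCycleLink {α : Type*} [Fintype α] [DecidableEq α] (G : Subgroup (Perm α)) (a b : α) :
    Prop :=
  ∃ σ ∈ G, σ.IsThreeCycle ∧ σ a ≠ a ∧ σ b ≠ b

/-- A block that contains two points, one of which is moved by a three-cycle of `G`, contains all
points moved by that three-cycle: otherwise the cycle would move the block off itself, hence move
every point of it, but two points of a three-cycle are always consecutive. -/
theorem ThreeCycleLink.mem_of_isBlock {α : Type*} [Fintype α] [DecidableEq α]
    {G : Subgroup (Perm α)} {B : Set α} (hB : MulAction.IsBlock G B) {a a' b : α} (ha : a ∈ B)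
    (ha' : a' ∈ B) (haa' : a ≠ a') (h : ThreeCycleLink G a b) : b ∈ B := by
  obtain ⟨σ, hσ, h3, hσa, hσb⟩ := h
  have hcube : ∀ z, σ (σ (σ z)) = z := fun z => by
    have := congrArg (fun τ : Perm α => τ z) (h3.orderOf ▸ pow_orderOf_eq_one σ)
    simpa [pow_succ] using this
  have horb : ∀ z, σ z ≠ z → z = a ∨ z = σ a ∨ z = σ (σ a) := fun z hz => by
    obtain ⟨i, hi⟩ := h3.isCycle.exists_pow_eq hσa hz
    have hmod : (σ ^ (i % 3)) a = z := by
      rw [← hi, ← h3.orderOf, pow_mod_orderOf]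
    have : i % 3 < 3 := Nat.mod_lt _ (by norm_num)
    interval_cases i % 3 <;> simp_all [pow_succ]
  have hstab : ∀ z ∈ B, σ z ∈ B → ∀ w ∈ B, σ w ∈ B := fun z hz hσz w hw => by
    have := hB.smul_eq_of_mem (g := (⟨σ, hσ⟩ : G)) hz hσz
    rw [← this]
    exact ⟨w, hw, rfl⟩
  have hfix : ∀ w ∈ B, σ w ∈ B := by
    by_cases hσa' : σ a' = a'
    · exact hstab a' ha' (by rwa [hσa'])
    · rcases horb a' hσa' with h | h | h
      · exact absurd h.symm haa'
      · exact hstab a ha (h ▸ ha')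
      · exact hstab a' ha' (by rw [h, hcube]; exact ha)
  rcases horb b hσb with rfl | rfl | rfl
  · exact ha
  · exact hfix _ ha
  · exact hfix _ (hfix _ ha)

/-- A permutation group whose three-cycles connect all points contains the alternating group. It is
primitive by the block lemma above, so that Jordan's theorem applies. -/
theorem alternatingGroup_le_of_connected {α : Type*} [Fintype α] [DecidableEq α]
    {G : Subgroup (Perm α)} (h : ∀ a b, Relation.EqvGen (ThreeCycleLink G) a b) :
    alternatingGroup α ≤ G := by
  rcases subsingleton_or_nontrivial α with hα | hα
  · intro π _
    rw [Subsingleton.elim π 1]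
    exact G.one_mem
  have hlink : ∃ a b, ThreeCycleLink G a b := by
    by_contra! hno
    obtain ⟨a, b, hab⟩ := exists_pair_ne α
    refine hab (Relation.EqvGen.rec (motive := fun a b _ => a = b) ?_ ?_ ?_ ?_ (h a b))
    · exact fun a b hab => absurd hab (hno a b)
    · exact fun _ => rfl
    · exact fun _ _ _ h => h.symm
    · exact fun _ _ _ _ _ h h' => h.trans h'
  obtain ⟨a, _, σ, hσ, h3, hσa, _⟩ := hlink
  refine Perm.alternatingGroup_le_of_isPreprimitive_of_isThreeCycle_mem ?_ h3 hσ
  refine MulAction.IsPreprimitive.of_isTrivialBlock_of_notMem_fixedPoints (a := a) ?_ ?_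
  · exact fun hfix => hσa (hfix ⟨σ, hσ⟩)
  · intro B ha hB
    rw [MulAction.IsTrivialBlock, or_iff_not_imp_left, Set.not_subsingleton_iff]
    intro hnt
    have key : ∀ x y, Relation.EqvGen (ThreeCycleLink G) x y → (x ∈ B ↔ y ∈ B) := by
      intro x y hxy
      induction hxy with
      | rel x y hxy =>
        constructor
        · intro hx
          obtain ⟨x', hx', hne⟩ := hnt.exists_ne x
          exact hxy.mem_of_isBlock hB hx hx' hne.symm
        · intro hy
          obtain ⟨y', hy', hne⟩ := hnt.exists_ne y
          obtain ⟨σ, hσ, h3, hx, hy2⟩ := hxy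
          exact ThreeCycleLink.mem_of_isBlock hB hy hy' hne.symm ⟨σ, hσ, h3, hy2, hx⟩
      | refl => exact Iff.rfl
      | symm _ _ _ ih => exact ih.symm
      | trans _ _ _ _ _ ih ih' => exact ih.trans ih'
    exact Set.eq_univ_of_forall fun b => (key a b (h a b)).1 ha

/-! ### Rows and columns -/

/-- A row or a column of the lattice. Rows and columns play the same role, so that what follows is
stated for lines. -/
inductive Line (Lx Ly : ℕ) : Type
  | row (y : Fin Ly)
  | col (x : Fin Lx)

namespace Line

variable {Lx Ly : ℕ}

/-- The number of vertices of a line. -/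
def len : Line Lx Ly → ℕ
  | row _ => Lx
  | col _ => Ly

/-- The bonds of a line, in order. -/
def bond : (ℓ : Line Lx Ly) → Fin (ℓ.len + 1) → Site Lx Ly
  | row y, i => .px i y
  | col x, j => .py x j

/-- The vertices of a line, in order. -/
def vertex : (ℓ : Line Lx Ly) → Fin ℓ.len → Site Lx Ly
  | row y, x => .d x y
  | col x, y => .d x y

/-- `a` and `c` are the two bonds of `ℓ` adjacent to its vertex number `v`, in either order. -/
def Ends (ℓ : Line Lx Ly) (v : Fin ℓ.len) (a c : Site Lx Ly) : Prop :=
  (a = ℓ.bond v.castSucc ∧ c = ℓ.bond v.succ) ∨ (a = ℓ.bond v.succ ∧ c = ℓ.bond v.castSucc)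

theorem bond_injective (ℓ : Line Lx Ly) : Function.Injective ℓ.bond := by
  cases ℓ
  · exact fun i j h => (Site.px.inj h).1
  · exact fun i j h => (Site.py.inj h).2

theorem bond_ne_bond {ℓ ℓ' : Line Lx Ly} (h : ℓ ≠ ℓ') (i : Fin (ℓ.len + 1))
    (j : Fin (ℓ'.len + 1)) : ℓ.bond i ≠ ℓ'.bond j := by
  intro hij
  cases ℓ <;> cases ℓ'
  · exact h (congrArg row (Site.px.inj hij).2)
  · cases hij
  · cases hij
  · exact h (congrArg col (Site.py.inj hij).1)

theorem bond_ne_d (ℓ : Line Lx Ly) (i : Fin (ℓ.len + 1)) (x : Fin Lx) (y : Fin Ly) :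
    ℓ.bond i ≠ .d x y := by
  cases ℓ <;> simp [bond]

theorem exists_vertex_eq (ℓ : Line Lx Ly) (v : Fin ℓ.len) : ∃ x y, ℓ.vertex v = .d x y := by
  cases ℓ
  · exact ⟨_, _, rfl⟩
  · exact ⟨_, _, rfl⟩

theorem bond_ne_vertex (ℓ ℓ' : Line Lx Ly) (i : Fin (ℓ.len + 1)) (v : Fin ℓ'.len) :
    ℓ.bond i ≠ ℓ'.vertex v := by
  obtain ⟨x, y, h⟩ := ℓ'.exists_vertex_eq v
  rw [h]
  exact ℓ.bond_ne_d i x y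

/-- Every vertex of a line also lies on a second line. -/
theorem exists_crossing (ℓ : Line Lx Ly) (v : Fin ℓ.len) :
    ∃ (ℓ' : Line Lx Ly) (v' : Fin ℓ'.len), ℓ' ≠ ℓ ∧ ℓ'.vertex v' = ℓ.vertex v := by
  cases ℓ with
  | row y => exact ⟨col v, y, by simp, rfl⟩
  | col x => exact ⟨row v, x, by simp, rfl⟩

theorem Ends.symm {ℓ : Line Lx Ly} {v : Fin ℓ.len} {a c : Site Lx Ly} (h : ℓ.Ends v a c) :
    ℓ.Ends v c a := by
  rcases h with ⟨ha, hc⟩ | ⟨ha, hc⟩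
  · exact .inr ⟨hc, ha⟩
  · exact .inl ⟨hc, ha⟩

theorem Ends.exists_left {ℓ : Line Lx Ly} {v : Fin ℓ.len} {a c : Site Lx Ly}
    (h : ℓ.Ends v a c) : ∃ i, a = ℓ.bond i := by
  rcases h with ⟨ha, _⟩ | ⟨ha, _⟩
  · exact ⟨_, ha⟩
  · exact ⟨_, ha⟩

theorem Ends.ne_d {ℓ : Line Lx Ly} {v : Fin ℓ.len} {a c : Site Lx Ly} (h : ℓ.Ends v a c)
    (x : Fin Lx) (y : Fin Ly) : a ≠ .d x y := by
  obtain ⟨i, rfl⟩ := h.exists_left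
  exact ℓ.bond_ne_d i x y

theorem Ends.ne_vertex {ℓ : Line Lx Ly} {v : Fin ℓ.len} {a c : Site Lx Ly} (h : ℓ.Ends v a c)
    (ℓ' : Line Lx Ly) (w : Fin ℓ'.len) : a ≠ ℓ'.vertex w := by
  obtain ⟨i, rfl⟩ := h.exists_left
  exact ℓ.bond_ne_vertex ℓ' i w

theorem Ends.ne_bond {ℓ ℓ' : Line Lx Ly} {v : Fin ℓ.len} {a c : Site Lx Ly} (h : ℓ.Ends v a c)
    (hℓ : ℓ ≠ ℓ') (i : Fin (ℓ'.len + 1)) : a ≠ ℓ'.bond i := by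
  obtain ⟨j, rfl⟩ := h.exists_left
  exact bond_ne_bond hℓ j i

theorem Ends.ne_of_ne {ℓ ℓ' : Line Lx Ly} {v : Fin ℓ.len} {v' : Fin ℓ'.len}
    {a c a' c' : Site Lx Ly} (h : ℓ.Ends v a c) (h' : ℓ'.Ends v' a' c') (hℓ : ℓ ≠ ℓ') :
    a ≠ a' := by
  obtain ⟨j, rfl⟩ := h'.exists_left
  exact h.ne_bond hℓ j

end Line

namespace Config

variable {Lx Ly N : ℕ}

/-- The site `s` is occupied in the configuration `r`. -/
def Occ (r : Config Lx Ly N) (s : Site Lx Ly) : Prop :=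
  ∃ k, r.pos k = s

theorem ext_pos {r r' : Config Lx Ly N} (h : r.pos = r'.pos) : r = r' := by
  cases r
  cases r'
  simpa using h

theorem occ_vertex (r : Config Lx Ly N) (ℓ : Line Lx Ly) (v : Fin ℓ.len) :
    r.Occ (ℓ.vertex v) := by
  obtain ⟨x, y, h⟩ := ℓ.exists_vertex_eq v
  rw [h]
  exact r.d_occupied x y

theorem step_iff {r r' : Config Lx Ly N} :
    Step r r' ↔ ∃ (ℓ : Line Lx Ly) (v : Fin ℓ.len) (a c : Site Lx Ly),
      ℓ.Ends v a c ∧ Hop a (ℓ.vertex v) c r r' := by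
  constructor
  · rintro ⟨x, y, δ, h⟩
    cases δ with
    | x =>
      rcases h with h | h
      · exact ⟨.row y, x, _, _, .inl ⟨rfl, rfl⟩, h⟩
      · exact ⟨.row y, x, _, _, .inr ⟨rfl, rfl⟩, h⟩
    | y =>
      rcases h with h | h
      · exact ⟨.col x, y, _, _, .inl ⟨rfl, rfl⟩, h⟩
      · exact ⟨.col x, y, _, _, .inr ⟨rfl, rfl⟩, h⟩
  · rintro ⟨ℓ, v, a, c, hac, h⟩
    cases ℓ with
    | row y =>
      rcases hac with ⟨rfl, rfl⟩ | ⟨rfl, rfl⟩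
      · exact ⟨v, y, .x, .inl h⟩
      · exact ⟨v, y, .x, .inr h⟩
    | col x =>
      rcases hac with ⟨rfl, rfl⟩ | ⟨rfl, rfl⟩
      · exact ⟨x, v, .y, .inl h⟩
      · exact ⟨x, v, .y, .inr h⟩

/-! ### Single hops -/

theorem Hop.symm {a b c : Site Lx Ly} {r r' : Config Lx Ly N} (h : Hop a b c r r') :
    Hop c b a r' r := by
  obtain ⟨k, l, hk, hl, hc, hk', hl', hm⟩ := h
  refine ⟨l, k, hl', hk', fun m hma => ?_, hl, hk, fun m h1 h2 => (hm m h2 h1).symm⟩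
  by_cases h1 : m = k
  · subst h1
    have : m = l := r.pos_injective (by rw [hl, ← hk', hma, hk])
    subst this
    exact hc m (by rw [hl, ← hk', hl'])
  by_cases h2 : m = l
  · subst h2
    exact hc k (by rw [hk, ← hl', hma])
  exact h1 (r.pos_injective (by rw [hk, ← hma, hm m h1 h2]))

theorem Hop.permute {a b c : Site Lx Ly} {r r' : Config Lx Ly N} (h : Hop a b c r r')
    (π : Perm (Fin N)) : Hop a b c (r.permute π) (r'.permute π) := by
  obtain ⟨k, l, hk, hl, hc, hk', hl', hm⟩ := h
  refine ⟨π.symm k, π.symm l, by simpa [Config.permute] using hk,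
    by simpa [Config.permute] using hl, fun m => hc (π m), by simpa [Config.permute] using hk',
    by simpa [Config.permute] using hl', fun m h1 h2 => hm (π m) ?_ ?_⟩
  · rintro rfl
    simp at h1
  · rintro rfl
    simp at h2

/-- On the level of occupation numbers, a hop exchanges the occupied and the empty bond. -/
theorem Hop.occ_iff [DecidableEq (Site Lx Ly)] {a b c : Site Lx Ly} {r r' : Config Lx Ly N}
    (h : Hop a b c r r') (s : Site Lx Ly) : r'.Occ s ↔ r.Occ (swap a c s) := by
  have h' := h.symm
  obtain ⟨k, l, hk, hl, hc, hk', hl', hm⟩ := h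
  obtain ⟨_, _, _, _, ha, _⟩ := h'
  by_cases hsa : s = a
  · subst hsa
    rw [swap_apply_left]
    exact ⟨fun ⟨m, h⟩ => absurd h (ha m), fun ⟨m, h⟩ => absurd h (hc m)⟩
  by_cases hsc : s = c
  · subst hsc
    rw [swap_apply_right]
    exact ⟨fun _ => ⟨k, hk⟩, fun _ => ⟨l, hl'⟩⟩
  rw [swap_apply_of_ne_of_ne hsa hsc]
  by_cases hsb : s = b
  · subst hsb
    exact ⟨fun _ => ⟨l, hl⟩, fun _ => ⟨k, hk'⟩⟩
  constructor
  · rintro ⟨m, rfl⟩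
    refine ⟨m, (hm m ?_ ?_).symm⟩
    · rintro rfl
      exact hsb hk'
    · rintro rfl
      exact hsc hl'
  · rintro ⟨m, rfl⟩
    refine ⟨m, hm m ?_ ?_⟩
    · rintro rfl
      exact hsa hk
    · rintro rfl
      exact hsb hl

/-- If `k` sits on the bond `a`, `l` on `b`, and `c` is empty, then the hop `a → b → c` can be
performed. -/
theorem exists_hop {a b c : Site Lx Ly} {r : Config Lx Ly N} {k l : Fin N} (hk : r.pos k = a)
    (hl : r.pos l = b) (hc : ¬ r.Occ c) (ha : ∀ x y, a ≠ .d x y) (hab : a ≠ b) :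
    ∃ r' : Config Lx Ly N, Hop a b c r r' ∧ r'.pos k = b ∧ r'.pos l = c ∧
      ∀ m, m ≠ k → m ≠ l → r'.pos m = r.pos m := by
  have hkl : k ≠ l := by
    rintro rfl
    exact hab (hk.symm.trans hl)
  have hc' : ∀ m, r.pos m ≠ c := fun m hm => hc ⟨m, hm⟩
  let p : Fin N → Site Lx Ly := Function.update (Function.update r.pos k b) l c
  have pk : p k = b := by simp [p, hkl]
  have pl : p l = c := by simp [p]
  have pm : ∀ m, m ≠ k → m ≠ l → p m = r.pos m := fun m h1 h2 => by simp [p, h1, h2]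
  have pinj : Function.Injective p := by
    have hinj := r.pos_injective
    intro m n hmn
    by_cases m = k <;> by_cases m = l <;> by_cases n = k <;> by_cases n = l <;>
      grind [Function.Injective]
  refine ⟨⟨p, pinj, fun x y => ?_⟩, ⟨k, l, hk, hl, hc', pk, pl, pm⟩, pk, pl, pm⟩
  obtain ⟨m, hm⟩ := r.d_occupied x y
  by_cases h1 : m = l
  · exact ⟨k, by rw [pk, ← hl, ← h1, hm]⟩
  · exact ⟨m, by rw [pm m (fun h => ha x y (by rw [← hk, ← h, hm])) h1, hm]⟩

/-! ### Reachability and the group of induced permutations -/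

/-- `r'` can be reached from `r` by a finite sequence of moves. -/
abbrev Reach (r r' : Config Lx Ly N) : Prop :=
  Relation.ReflTransGen Step r r'

theorem Step.symm {r r' : Config Lx Ly N} (h : Step r r') : Step r' r := by
  rw [step_iff] at h ⊢
  obtain ⟨ℓ, v, a, c, hac, h⟩ := h
  exact ⟨ℓ, v, c, a, hac.symm, h.symm⟩

theorem Reach.symm {r r' : Config Lx Ly N} (h : Reach r r') : Reach r' r := by
  induction h with
  | refl => exact .refl
  | tail _ h ih => exact .head h.symm ih

theorem Reach.permute {r r' : Config Lx Ly N} (h : Reach r r') (π : Perm (Fin N)) :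
    Reach (r.permute π) (r'.permute π) := by
  refine Relation.ReflTransGen.lift (fun s : Config Lx Ly N => s.permute π)
    (fun s s' hs => ?_) _ _ h
  obtain ⟨ℓ, v, a, c, hac, h⟩ := step_iff.1 hs
  exact step_iff.2 ⟨ℓ, v, a, c, hac, h.permute π⟩

/-- The permutations induced at `r` form a group, because moves are reversible and commute with
relabelling the electrons. -/
def inducedGroup (r : Config Lx Ly N) : Subgroup (Perm (Fin N)) where
  carrier := {π | r.Induces π}
  one_mem' := Relation.ReflTransGen.refl
  mul_mem' := fun {π ρ} hπ hρ =>
    Relation.ReflTransGen.trans (show Reach r (r.permute ρ) from hρ)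
      (show Reach (r.permute ρ) (r.permute (π * ρ)) from Reach.permute hπ ρ)
  inv_mem' := fun {π} hπ => by
    have h : Reach (r.permute π⁻¹) ((r.permute π).permute π⁻¹) := Reach.permute hπ π⁻¹
    have h1 : (r.permute π).permute π⁻¹ = r := ext_pos (by funext m; simp [Config.permute])
    rw [h1] at h
    exact h.symm

theorem mem_inducedGroup_of_reach {r s : Config Lx Ly N} (h : Reach r s) {π : Perm (Fin N)}
    (hπ : Reach s (s.permute π)) : π ∈ r.inducedGroup :=
  show Reach r (r.permute π) from (h.trans hπ).trans (h.permute π).symm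

/-- Two electrons are linked when they are connected by a chain of induced three-cycles. -/
def Linked (r : Config Lx Ly N) : Fin N → Fin N → Prop :=
  Relation.EqvGen (ThreeCycleLink r.inducedGroup)

theorem Linked.symm {r : Config Lx Ly N} {k l : Fin N} (h : r.Linked k l) : r.Linked l k :=
  Relation.EqvGen.symm _ _ h

theorem Linked.trans {r : Config Lx Ly N} {k l m : Fin N} (h : r.Linked k l)
    (h' : r.Linked l m) : r.Linked k m :=
  Relation.EqvGen.trans _ _ _ h h'

/-- The mechanism behind ergodicity. If a vertex has one occupied and one empty bond in each of the
two directions, then the commutator of the two hops over it is a three-cycle of the electron on the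
vertex and those on the two occupied bonds. -/
theorem linked_of_crossing {r s : Config Lx Ly N} (hrs : Reach r s) {ℓ ℓ' : Line Lx Ly}
    {v : Fin ℓ.len} {v' : Fin ℓ'.len} {a c a' c' : Site Lx Ly} (hℓ : ℓ ≠ ℓ')
    (hv : ℓ'.vertex v' = ℓ.vertex v) (hac : ℓ.Ends v a c) (hac' : ℓ'.Ends v' a' c')
    {k l m : Fin N} (hk : s.pos k = a) (hl : s.pos l = ℓ.vertex v) (hm : s.pos m = a')
    (hc : ¬ s.Occ c) (hc' : ¬ s.Occ c') : r.Linked k l ∧ r.Linked m l := by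
  classical
  generalize hb : ℓ.vertex v = b at *
  have hab : a ≠ b := hb ▸ hac.ne_vertex ℓ v
  have hcb : c ≠ b := hb ▸ hac.symm.ne_vertex ℓ v
  have hab' : a' ≠ b := hv ▸ hac'.ne_vertex ℓ' v'
  have hcb' : c' ≠ b := hv ▸ hac'.symm.ne_vertex ℓ' v'
  have haa' : a ≠ a' := hac.ne_of_ne hac' hℓ
  have hcc' : c ≠ c' := hac.symm.ne_of_ne hac'.symm hℓ
  have hac1 : a ≠ c' := hac.ne_of_ne hac'.symm hℓ
  have hac2 : c ≠ a' := hac.symm.ne_of_ne hac' hℓ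
  have hne : a ≠ c := fun h => hc ⟨k, hk.trans h⟩
  have hne' : a' ≠ c' := fun h => hc' ⟨m, hm.trans h⟩
  have hkl : k ≠ l := fun h => hab (by rw [← hk, ← hl, h])
  have hml : m ≠ l := fun h => hab' (by rw [← hm, ← hl, h])
  have hkm : k ≠ m := fun h => haa' (by rw [← hk, ← hm, h])
  obtain ⟨s₁, h₁, h₁k, h₁l, h₁o⟩ := exists_hop hk hl hc hac.ne_d hab
  have h₁m : s₁.pos m = a' := (h₁o m hkm.symm hml).trans hm
  have h₁c : ¬ s₁.Occ c' := by
    rwa [h₁.occ_iff, swap_apply_of_ne_of_ne hac1.symm hcc'.symm]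
  obtain ⟨s₂, h₂, h₂m, h₂k, h₂o⟩ := exists_hop h₁m h₁k h₁c hac'.ne_d hab'
  have h₂l : s₂.pos l = c := (h₂o l hml.symm hkl.symm).trans h₁l
  have h₂a : ¬ s₂.Occ a := by
    rwa [h₂.occ_iff, swap_apply_of_ne_of_ne haa' hac1, h₁.occ_iff, swap_apply_left]
  obtain ⟨s₃, h₃, h₃l, h₃m, h₃o⟩ := exists_hop h₂l h₂m h₂a hac.symm.ne_d hcb
  have h₃k : s₃.pos k = c' := (h₃o k hkl hkm).trans h₂k
  have h₃a : ¬ s₃.Occ a' := by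
    rwa [h₃.occ_iff, swap_apply_of_ne_of_ne hac2.symm haa'.symm, h₂.occ_iff, swap_apply_left]
  obtain ⟨s₄, h₄, h₄k, h₄l, h₄o⟩ := exists_hop h₃k h₃l h₃a hac'.symm.ne_d hcb'
  have h₄m : s₄.pos m = a := (h₄o m hkm.symm hml).trans h₃m
  have hreach : Reach s s₄ := by
    have t₁ : Step s s₁ := step_iff.2 ⟨ℓ, v, a, c, hac, hb ▸ h₁⟩
    have t₂ : Step s₁ s₂ := step_iff.2 ⟨ℓ', v', a', c', hac', hv ▸ h₂⟩
    have t₃ : Step s₂ s₃ := step_iff.2 ⟨ℓ, v, c, a, hac.symm, hb ▸ h₃⟩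
    have t₄ : Step s₃ s₄ := step_iff.2 ⟨ℓ', v', c', a', hac'.symm, hv ▸ h₄⟩
    exact (((Relation.ReflTransGen.single t₁).tail t₂).tail t₃).tail t₄
  -- The four hops `s → s₁ → s₂ → s₃ → s₄` form the commutator. In the end `k` has taken
  -- the place of `l`, `l` that of `m`, and `m` that of `k`.
  let π : Perm (Fin N) := swap m l * swap m k
  have πk : π k = l := by simp [π]
  have πl : π l = m := by simp [π, swap_apply_of_ne_of_ne hml.symm hkl.symm]
  have πm : π m = k := by simp [π, swap_apply_of_ne_of_ne hkm hkl]
  have hπ : s₄ = s.permute π := by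
    refine ext_pos (funext fun n => ?_)
    change s₄.pos n = s.pos (π n)
    by_cases hnk : n = k
    · rw [hnk, πk, h₄k, hl]
    by_cases hnl : n = l
    · rw [hnl, πl, h₄l, hm]
    by_cases hnm : n = m
    · rw [hnm, πm, h₄m, hk]
    have πn : π n = n := by
      simp [π, swap_apply_of_ne_of_ne hnm hnk, swap_apply_of_ne_of_ne hnm hnl]
    rw [πn, h₄o n hnk hnl, h₃o n hnl hnm, h₂o n hnm hnk, h₁o n hnk hnl]
  have hmem : π ∈ r.inducedGroup := mem_inducedGroup_of_reach hrs (hπ ▸ hreach)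
  have h3 : π.IsThreeCycle := Perm.isThreeCycle_swap_mul_swap_same hml hkm.symm hkl.symm
  exact ⟨.rel _ _ ⟨π, hmem, h3, πk ▸ hkl.symm, πl ▸ hml⟩,
    .rel _ _ ⟨π, hmem, h3, πm ▸ hkm, πl ▸ hml⟩⟩

/-! ### Rearranging the bonds of a line -/

/-- Reachability by moves along the line `ℓ` only. -/
def LineReach (ℓ : Line Lx Ly) : Config Lx Ly N → Config Lx Ly N → Prop :=
  Relation.ReflTransGen fun r r' =>
    ∃ (v : Fin ℓ.len) (a c : Site Lx Ly), ℓ.Ends v a c ∧ Hop a (ℓ.vertex v) c r r'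

theorem LineReach.reach {ℓ : Line Lx Ly} {r r' : Config Lx Ly N} (h : LineReach ℓ r r') :
    Reach r r' :=
  Relation.ReflTransGen.mono (fun _ _ ⟨v, a, c, h⟩ => step_iff.2 ⟨ℓ, v, a, c, h⟩) _ _ h

/-- Moves along a line can permute the occupation numbers of its bonds arbitrarily: exchanging those
of two neighbouring bonds is a hop if they differ, and nothing at all if they agree. -/
theorem exists_lineReach_occ (ℓ : Line Lx Ly) (e : Perm (Fin (ℓ.len + 1)))
    (r : Config Lx Ly N) :
    ∃ s, LineReach ℓ r s ∧ ∀ i, s.Occ (ℓ.bond i) ↔ r.Occ (ℓ.bond (e i)) := by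
  classical
  have he : e ∈ Submonoid.closure
      (Set.range fun i : Fin ℓ.len => swap i.castSucc i.succ) := by
    rw [Perm.mclosure_swap_castSucc_succ]
    exact Submonoid.mem_top e
  induction he using Submonoid.closure_induction generalizing r with
  | mem e he =>
    obtain ⟨v, rfl⟩ := he
    have hswap : ∀ i, swap (ℓ.bond v.castSucc) (ℓ.bond v.succ) (ℓ.bond i) =
        ℓ.bond (swap v.castSucc v.succ i) := fun i => (ℓ.bond_injective.map_swap _ _ _).symm
    obtain ⟨l, hl⟩ := r.occ_vertex ℓ v
    by_cases h1 : r.Occ (ℓ.bond v.castSucc) <;> by_cases h2 : r.Occ (ℓ.bond v.succ)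
    · refine ⟨r, .refl, fun i => ?_⟩
      rcases eq_or_ne i v.castSucc with rfl | hi
      · simp [h1, h2]
      rcases eq_or_ne i v.succ with rfl | hi'
      · simp [h1, h2]
      simp [swap_apply_of_ne_of_ne hi hi']
    · obtain ⟨k, hk⟩ := h1
      obtain ⟨s, hs, _⟩ := exists_hop hk hl h2 (ℓ.bond_ne_d _) (ℓ.bond_ne_vertex _ _ _)
      exact ⟨s, .single ⟨v, _, _, .inl ⟨rfl, rfl⟩, hs⟩, fun i => by rw [hs.occ_iff, hswap]⟩
    · obtain ⟨k, hk⟩ := h2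
      obtain ⟨s, hs, _⟩ := exists_hop hk hl h1 (ℓ.bond_ne_d _) (ℓ.bond_ne_vertex _ _ _)
      exact ⟨s, .single ⟨v, _, _, .inr ⟨rfl, rfl⟩, hs⟩,
        fun i => by rw [hs.occ_iff, swap_comm, hswap]⟩
    · refine ⟨r, .refl, fun i => ?_⟩
      rcases eq_or_ne i v.castSucc with rfl | hi
      · simp [h1, h2]
      rcases eq_or_ne i v.succ with rfl | hi'
      · simp [h1, h2]
      simp [swap_apply_of_ne_of_ne hi hi']
  | one => exact ⟨r, .refl, fun _ => Iff.rfl⟩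
  | mul e f _ _ ihe ihf =>
    obtain ⟨s, hs, hso⟩ := ihe r
    obtain ⟨t, ht, hto⟩ := ihf s
    exact ⟨t, Relation.ReflTransGen.trans hs ht, fun i => by rw [hto, hso]; rfl⟩

/-- Every line has an occupied bond and two empty ones. -/
def Mobile (r : Config Lx Ly N) : Prop :=
  ∀ ℓ : Line Lx Ly, ∃ i j j', j ≠ j' ∧ r.Occ (ℓ.bond i) ∧ ¬ r.Occ (ℓ.bond j) ∧
    ¬ r.Occ (ℓ.bond j')

theorem Mobile.step {r s : Config Lx Ly N} (hr : r.Mobile) (h : Step r s) : s.Mobile := by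
  classical
  intro ℓ
  obtain ⟨ℓ', v, a, c, hac, h⟩ := step_iff.1 h
  have hperm : ∃ e : Perm (Fin (ℓ.len + 1)), ∀ i, s.Occ (ℓ.bond (e i)) ↔ r.Occ (ℓ.bond i) := by
    by_cases hℓ : ℓ' = ℓ
    · subst hℓ
      refine ⟨swap v.castSucc v.succ, fun i => ?_⟩
      have : swap a c = swap (ℓ'.bond v.castSucc) (ℓ'.bond v.succ) := by
        rcases hac with ⟨rfl, rfl⟩ | ⟨rfl, rfl⟩
        · rfl
        · exact swap_comm _ _
      rw [h.occ_iff, this, ← ℓ'.bond_injective.map_swap, swap_apply_self]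
    · refine ⟨1, fun i => ?_⟩
      rw [h.occ_iff, Perm.one_apply,
        swap_apply_of_ne_of_ne (hac.ne_bond hℓ i).symm (hac.symm.ne_bond hℓ i).symm]
  obtain ⟨e, he⟩ := hperm
  obtain ⟨i, j, j', hne, hi, hj, hj'⟩ := hr ℓ
  exact ⟨e i, e j, e j', e.injective.ne hne, (he i).2 hi, fun h => hj ((he j).1 h),
    fun h => hj' ((he j').1 h)⟩

theorem Mobile.reach {r s : Config Lx Ly N} (hr : r.Mobile) (h : Reach r s) : s.Mobile := by
  induction h with
  | refl => exact hr
  | tail _ h ih => exact ih.step h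

/-- In a mobile configuration any three distinct bonds of a line can be made occupied, empty and
empty, respectively, by moves along the line. -/
theorem Mobile.exists_lineReach {r : Config Lx Ly N} (hr : r.Mobile) (ℓ : Line Lx Ly)
    {i j j' : Fin (ℓ.len + 1)} (hij : i ≠ j) (hij' : i ≠ j') (hjj' : j ≠ j') :
    ∃ s, LineReach ℓ r s ∧ s.Occ (ℓ.bond i) ∧ ¬ s.Occ (ℓ.bond j) ∧ ¬ s.Occ (ℓ.bond j') := by
  obtain ⟨i₀, j₀, j₀', hne, hi, hj, hj'⟩ := hr ℓ
  have h1 : i₀ ≠ j₀ := fun h => hj (h ▸ hi)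
  have h2 : i₀ ≠ j₀' := fun h => hj' (h ▸ hi)
  obtain ⟨e, hei, hej, hej'⟩ : ∃ e : Perm (Fin (ℓ.len + 1)), e i = i₀ ∧ e j = j₀ ∧ e j' = j₀' := by
    have inj : ∀ {a b c : Fin (ℓ.len + 1)}, a ≠ b → a ≠ c → b ≠ c →
        Function.Injective ![a, b, c] := fun hab hac hbc m n hmn => by
      fin_cases m <;> fin_cases n <;> simp_all
    obtain ⟨e, he⟩ := (Perm.isMultiplyPretransitive (Fin (ℓ.len + 1)) 3).exists_smul_eq
      ⟨_, inj hij hij' hjj'⟩ ⟨_, inj h1 h2 hne⟩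
    exact ⟨e, DFunLike.congr_fun he 0, DFunLike.congr_fun he 1, DFunLike.congr_fun he 2⟩
  obtain ⟨s, hs, hocc⟩ := exists_lineReach_occ ℓ e r
  exact ⟨s, hs, (hocc i).2 (hei ▸ hi), fun h => hj (hej ▸ (hocc j).1 h),
    fun h => hj' (hej' ▸ (hocc j').1 h)⟩

/-! ### Linking all electrons -/

/-- Whenever a hop over a vertex is possible, the two electrons that it would move are linked. Moving
along the crossing line until the crossing direction also has an occupied and an empty bond at
the vertex, either the electron on the vertex never changes, or the first hop that changes it
already links it to the electron on the bond. -/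
theorem linked_of_hop {r s : Config Lx Ly N} (hr : r.Mobile) (hrs : Reach r s)
    {ℓ : Line Lx Ly} {v : Fin ℓ.len} {a c : Site Lx Ly} (hac : ℓ.Ends v a c) {k l : Fin N}
    (hk : s.pos k = a) (hl : s.pos l = ℓ.vertex v) (hc : ¬ s.Occ c) : r.Linked k l := by
  classical
  obtain ⟨ℓ', v', hℓ, hv⟩ := ℓ.exists_crossing v
  have key : ∀ t, LineReach ℓ' s t → t.pos k = a ∧ ¬ t.Occ c ∧
      (t.pos l = ℓ.vertex v ∨ r.Linked k l) := by
    intro t ht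
    induction ht with
    | refl => exact ⟨hk, hc, .inl hl⟩
    | @tail t t' ht hh ih =>
      obtain ⟨hk, hc, hl⟩ := ih
      obtain ⟨w, a', c', hac', hop⟩ := hh
      have hocc : ¬ t'.Occ c := by
        rwa [hop.occ_iff, swap_apply_of_ne_of_ne (hac.symm.ne_of_ne hac' hℓ.symm)
          (hac.symm.ne_of_ne hac'.symm hℓ.symm)]
      obtain ⟨k', l', hk', hl', hcc, _, _, ho⟩ := hop
      refine ⟨?_, hocc, ?_⟩
      · rw [ho k ?_ ?_, hk]
        · rintro rfl
          exact hac.ne_of_ne hac' hℓ.symm (hk.symm.trans hk')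
        · rintro rfl
          exact hac.ne_vertex ℓ' w (hk.symm.trans hl')
      · rcases hl with hl | hl
        · by_cases h1 : l = k'
          · subst h1
            exact absurd (hk'.symm.trans hl) (hac'.ne_vertex ℓ v)
          by_cases h2 : l = l'
          · have hw : ℓ'.vertex w = ℓ.vertex v := by rw [← hl', ← h2, hl]
            exact .inr (linked_of_crossing (hrs.trans (LineReach.reach ht)) hℓ.symm hw hac hac' hk
              hl hk' hc (fun ⟨m, hm⟩ => hcc m hm)).1
          · exact .inl ((ho l h1 h2).trans hl)
        · exact .inr hl
  obtain ⟨i, j, j', hne, hi, hj, hj'⟩ := hr.reach hrs ℓ'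
  obtain ⟨t, ht, htk, htc⟩ : ∃ t, LineReach ℓ' s t ∧ t.Occ (ℓ'.bond v'.castSucc) ∧
      ¬ t.Occ (ℓ'.bond v'.succ) := by
    have h1 : i ≠ j := fun h => hj (h ▸ hi)
    obtain ⟨e, he⟩ := (Perm.isMultiplyPretransitive (Fin (ℓ'.len + 1)) 2).exists_smul_eq
      ⟨![v'.castSucc, v'.succ], fun m n hmn => by
        have := Fin.castSucc_lt_succ (i := v') |>.ne
        fin_cases m <;> fin_cases n <;> simp_all⟩
      ⟨![i, j], fun m n hmn => by fin_cases m <;> fin_cases n <;> simp_all⟩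
    have e0 : e v'.castSucc = i := DFunLike.congr_fun he 0
    have e1 : e v'.succ = j := DFunLike.congr_fun he 1
    obtain ⟨t, ht, hocc⟩ := exists_lineReach_occ ℓ' e s
    exact ⟨t, ht, (hocc _).2 (e0 ▸ hi), fun h => hj (e1 ▸ (hocc _).1 h)⟩
  obtain ⟨hk, hc, hl⟩ := key t ht
  rcases hl with hl | hl
  · obtain ⟨m, hm⟩ := htk
    exact (linked_of_crossing (hrs.trans ht.reach) hℓ.symm hv hac (.inl ⟨rfl, rfl⟩) hk hl hm hc
      htc).1
  · exact hl

/-- The electron on a given vertex changes only within its class of linked electrons. -/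
theorem linked_of_reach_vertex {r s : Config Lx Ly N} (hr : r.Mobile) (hrs : Reach r s)
    {ℓ : Line Lx Ly} {v : Fin ℓ.len} {k k' : Fin N} (hk : r.pos k = ℓ.vertex v)
    (hk' : s.pos k' = ℓ.vertex v) : r.Linked k k' := by
  induction hrs generalizing k' with
  | refl =>
    rw [r.pos_injective (hk.trans hk'.symm)]
    exact .refl _
  | @tail t t' ht h ih =>
    obtain ⟨ℓ', w, a, c, hac, k₀, l₀, hk₀, hl₀, hc, hk₀', hl₀', ho⟩ := step_iff.1 h
    by_cases h1 : k' = k₀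
    · subst h1
      exact (ih (by rw [hl₀, ← hk₀', hk'])).trans
        (linked_of_hop hr ht hac hk₀ hl₀ (fun ⟨m, hm⟩ => hc m hm)).symm
    by_cases h2 : k' = l₀
    · subst h2
      exact absurd (hl₀'.symm.trans hk') (hac.symm.ne_vertex ℓ v)
    · exact ih ((ho k' h1 h2).symm.trans hk')

/-- The electrons on two consecutive vertices of a line are linked: with two empty bonds, one
occupied bond can be carried over both vertices. -/
theorem linked_of_adjacent {r : Config Lx Ly N} (hr : r.Mobile) (ℓ : Line Lx Ly) (n : ℕ)
    (hn : n + 1 < ℓ.len) {k k' : Fin N} (hk : r.pos k = ℓ.vertex ⟨n, by omega⟩)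
    (hk' : r.pos k' = ℓ.vertex ⟨n + 1, hn⟩) : r.Linked k k' := by
  classical
  let v : Fin ℓ.len := ⟨n, by omega⟩
  let w : Fin ℓ.len := ⟨n + 1, hn⟩
  have hv : ℓ.Ends v (ℓ.bond v.castSucc) (ℓ.bond v.succ) := .inl ⟨rfl, rfl⟩
  have hw : ℓ.Ends w (ℓ.bond v.succ) (ℓ.bond w.succ) := .inl ⟨rfl, rfl⟩
  have n1 : v.castSucc ≠ v.succ := by simp [Fin.ext_iff]
  have n2 : v.castSucc ≠ w.succ := by
    simp only [ne_eq, Fin.ext_iff, Fin.val_castSucc, Fin.val_succ, v, w]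
    omega
  have n3 : v.succ ≠ w.succ := by simp [Fin.ext_iff, v, w]
  obtain ⟨s, hs, ⟨f, hf⟩, hs1, hs2⟩ := hr.exists_lineReach ℓ n1 n2 n3
  obtain ⟨e, he⟩ := s.occ_vertex ℓ v
  obtain ⟨t, hst, htf, hte, hto⟩ := exists_hop hf he hs1 hv.ne_d (hv.ne_vertex _ _)
  have hrt : Reach r t := hs.reach.tail (step_iff.2 ⟨ℓ, v, _, _, hv, hst⟩)
  have ht2 : ¬ t.Occ (ℓ.bond w.succ) := by
    rwa [hst.occ_iff, swap_apply_of_ne_of_ne (ℓ.bond_injective.ne n2.symm)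
      (ℓ.bond_injective.ne n3.symm)]
  obtain ⟨e', he'⟩ := t.occ_vertex ℓ w
  have h1 : r.Linked k e := linked_of_reach_vertex hr hs.reach hk he
  have h2 : r.Linked e e' := linked_of_hop hr hrt hw hte he' ht2
  have h3 : r.Linked k' e' := linked_of_reach_vertex hr hrt hk' he'
  exact (h1.trans h2).trans h3.symm

theorem linked_of_line {r : Config Lx Ly N} (hr : r.Mobile) (ℓ : Line Lx Ly) (v w : Fin ℓ.len)
    {k k' : Fin N} (hk : r.pos k = ℓ.vertex v) (hk' : r.pos k' = ℓ.vertex w) :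
    r.Linked k k' := by
  have key : ∀ (n : ℕ) (hn : n < ℓ.len) (m : Fin N), r.pos m = ℓ.vertex ⟨n, hn⟩ →
      ∀ m₀, r.pos m₀ = ℓ.vertex ⟨0, by omega⟩ → r.Linked m₀ m := by
    intro n
    induction n with
    | zero =>
      intro hn m hm m₀ hm₀
      rw [r.pos_injective (hm.trans hm₀.symm)]
      exact .refl _
    | succ n ih =>
      intro hn m hm m₀ hm₀
      obtain ⟨m', hm'⟩ := r.occ_vertex ℓ ⟨n, by omega⟩
      exact (ih (by omega) m' hm' m₀ hm₀).trans (linked_of_adjacent hr ℓ n hn hm' hm)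
  obtain ⟨m₀, hm₀⟩ := r.occ_vertex ℓ ⟨0, v.pos⟩
  exact (key v v.2 k hk m₀ hm₀).symm.trans (key w w.2 k' hk' m₀ hm₀)

theorem linked_of_vertex {r : Config Lx Ly N} (hr : r.Mobile) {x x' : Fin Lx} {y y' : Fin Ly}
    {k k' : Fin N} (hk : r.pos k = .d x y) (hk' : r.pos k' = .d x' y') : r.Linked k k' := by
  obtain ⟨m, hm⟩ := r.d_occupied x' y
  exact (linked_of_line hr (.row y) x x' hk hm).trans (linked_of_line hr (.col x') y y' hm hk')

/-- Every electron is linked to every electron on a vertex. An electron on a bond has to move when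
that bond is emptied, and its first hop links it to an electron on a vertex. -/
theorem linked_vertex {r : Config Lx Ly N} (hr : r.Mobile) {x : Fin Lx} {y : Fin Ly}
    {k l : Fin N} (hl : r.pos l = .d x y) : r.Linked k l := by
  classical
  have key : ∀ s, Reach r s → s.pos k = r.pos k ∨ r.Linked k l := by
    intro s hs
    induction hs with
    | refl => exact .inl rfl
    | @tail t t' ht h ih =>
      rcases ih with ih | ih
      · obtain ⟨ℓ, w, a, c, hac, k₀, l₀, hk₀, hl₀, hc, -, -, ho⟩ := step_iff.1 h
        have h0 : r.Linked k₀ l₀ := linked_of_hop hr ht hac hk₀ hl₀ (fun ⟨m, hm⟩ => hc m hm)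
        have h1 : r.Linked l₀ l := by
          obtain ⟨m, hm⟩ := r.occ_vertex ℓ w
          obtain ⟨x', y', hxy⟩ := ℓ.exists_vertex_eq w
          exact (linked_of_reach_vertex hr ht hm hl₀).symm.trans
            (linked_of_vertex hr (hm.trans hxy) hl)
        by_cases hk : k = k₀
        · exact .inr (hk ▸ h0.trans h1)
        by_cases hk' : k = l₀
        · exact .inr (hk' ▸ h1)
        · exact .inl ((ho k hk hk').trans ih)
      · exact .inr ih
  have hbond : ∀ (ℓ : Line Lx Ly) (i : Fin (ℓ.len + 1)), r.pos k = ℓ.bond i → r.Linked k l := by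
    intro ℓ i hi
    obtain ⟨-, j, -, -, -, hj, -⟩ := hr ℓ
    obtain ⟨s, hs, hocc⟩ := exists_lineReach_occ ℓ (swap i j) r
    refine (key s hs.reach).resolve_left fun hk => hj ?_
    have := (hocc i).1 ⟨k, hk.trans hi⟩
    rwa [swap_apply_left] at this
  cases hk : r.pos k with
  | d x' y' => exact linked_of_vertex hr hk hl
  | px i y' => exact hbond (.row y') i hk
  | py x' j => exact hbond (.col x') j hk

theorem linked_all {r : Config Lx Ly N} (hr : r.Mobile) (k k' : Fin N) : r.Linked k k' := by
  -- A line with two distinct bonds has a vertex.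
  have hlen : ∀ ℓ : Line Lx Ly, 0 < ℓ.len := fun ℓ => by
    obtain ⟨_, j, j', hne, _⟩ := hr ℓ
    by_contra h
    exact hne (Fin.ext (by omega))
  obtain ⟨ℓ⟩ : Nonempty (Line Lx Ly) := by
    cases r.pos k with
    | d x y => exact ⟨.row y⟩
    | px i y => exact ⟨.row y⟩
    | py x j => exact ⟨.col x⟩
  obtain ⟨x, y, hxy⟩ := ℓ.exists_vertex_eq ⟨0, hlen ℓ⟩
  obtain ⟨l, hl⟩ := r.d_occupied x y
  exact (linked_vertex hr hl).trans (linked_vertex hr hl).symm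

theorem induces_of_sign_eq_one {r : Config Lx Ly N} (hr : r.Mobile) {π : Perm (Fin N)}
    (hπ : Perm.sign π = 1) : r.Induces π :=
  alternatingGroup_le_of_connected (G := r.inducedGroup) (linked_all hr)
    (Perm.mem_alternatingGroup.2 hπ)

/-- The condition on the electron counts gives an occupied and two empty bonds on every line, because
a line has one bond more than it has vertices. -/
theorem mobile_of_count {r : Config Lx Ly N}
    (h : ∀ ℓ : Line Lx Ly, 0 < {k | ∃ i, r.pos k = ℓ.bond i}.ncard ∧
      {k | ∃ i, r.pos k = ℓ.bond i}.ncard < ℓ.len) : r.Mobile := by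
  intro ℓ
  obtain ⟨h0, h1⟩ := h ℓ
  obtain ⟨k, i, hk⟩ := (Set.ncard_pos (Set.toFinite _)).1 h0
  let S : Set (Fin (ℓ.len + 1)) := {i | r.Occ (ℓ.bond i)}
  have hS : S.ncard ≤ {k | ∃ i, r.pos k = ℓ.bond i}.ncard := by
    have hch : ∀ i : Fin (ℓ.len + 1), ∃ k, i ∈ S → r.pos k = ℓ.bond i := fun i => by
      by_cases hi : i ∈ S
      · obtain ⟨k, hk⟩ := hi
        exact ⟨k, fun _ => hk⟩
      · exact ⟨k, fun h => absurd h hi⟩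
    choose f hf using hch
    refine Set.ncard_le_ncard_of_injOn f (fun i hi => ⟨i, hf i hi⟩) (fun i hi j hj hij => ?_)
      (Set.toFinite _)
    exact ℓ.bond_injective (by rw [← hf i hi, ← hf j hj, hij])
  have hcompl := Set.ncard_add_ncard_compl S
  rw [Nat.card_eq_fintype_card, Fintype.card_fin] at hcompl
  obtain ⟨j, hj, j', hj', hne⟩ := (Set.one_lt_ncard (Set.toFinite Sᶜ)).1 (by omega)
  exact ⟨i, j, j', hne, ⟨k, hk⟩, hj, hj'⟩

/-! ### The parity invariant -/

/-- A linear order on the sites, by an injection into a lexicographic product, for which the bonds of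
each line are consecutive. -/
def siteKey : Site Lx Ly → ℕ ×ₗ ℕ ×ₗ ℕ
  | .d x y => toLex (0, toLex (x, y))
  | .px i y => toLex (1, toLex (y, i))
  | .py x j => toLex (2, toLex (x, j))

theorem siteKey_injective : Function.Injective (siteKey : Site Lx Ly → _) := by
  intro s t h
  cases s <;> cases t <;> simp_all [siteKey, Fin.ext_iff]

/-- No site lies strictly between two neighbouring bonds of a line. -/
theorem siteKey_lt_iff {ℓ : Line Lx Ly} {v : Fin ℓ.len} {a c s : Site Lx Ly}
    (hac : ℓ.Ends v a c) (hsa : s ≠ a) (hsc : s ≠ c) :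
    (siteKey s < siteKey a ↔ siteKey s < siteKey c) ∧
      (siteKey a < siteKey s ↔ siteKey c < siteKey s) := by
  have hsa' := siteKey_injective.ne hsa
  have hsc' := siteKey_injective.ne hsc
  obtain ⟨t, y, h0, h1⟩ : ∃ t y : ℕ, siteKey (ℓ.bond v.castSucc) = toLex (t, toLex (y, v.1)) ∧
      siteKey (ℓ.bond v.succ) = toLex (t, toLex (y, v.1 + 1)) := by
    cases ℓ
    · exact ⟨_, _, rfl, rfl⟩
    · exact ⟨_, _, rfl, rfl⟩
  obtain ⟨t', y', i, hs⟩ : ∃ t' y' i : ℕ, siteKey s = toLex (t', toLex (y', i)) :=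
    ⟨_, _, _, rfl⟩
  rcases hac with ⟨rfl, rfl⟩ | ⟨rfl, rfl⟩ <;> rw [h0, hs] at * <;> rw [h1] at * <;>
    simp only [Prod.Lex.toLex_lt_toLex, ne_eq, EmbeddingLike.apply_eq_iff_eq, Prod.mk.injEq]
      at * <;> omega

/-- The number of a bond within its line; `0` on vertices. -/
def bondIndex : Site Lx Ly → ℕ
  | .d _ _ => 0
  | .px i _ => i
  | .py _ j => j

/-- The parity of a configuration: the sign of the permutation that sorts the electrons by position,
times the parity of the sum of the bond indices. -/
def parity (r : Config Lx Ly N) : ℤˣ :=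
  Perm.sign (Tuple.sort (siteKey ∘ r.pos)) * (-1) ^ ∑ k, bondIndex (r.pos k)

theorem sort_eq_of_monotone {n : ℕ} {α : Type*} [LinearOrder α] {f : Fin n → α}
    (hf : Function.Injective f) {σ : Perm (Fin n)} (hσ : Monotone (f ∘ σ)) :
    Tuple.sort f = σ :=
  Equiv.ext fun i => hf (congrFun (Tuple.unique_monotone (Tuple.monotone_sort f) hσ) i)

theorem parity_permute (r : Config Lx Ly N) (π : Perm (Fin N)) :
    (r.permute π).parity = Perm.sign π * r.parity := by
  have hinj : Function.Injective (siteKey ∘ (r.permute π).pos) :=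
    siteKey_injective.comp (r.permute π).pos_injective
  have hsort : Tuple.sort (siteKey ∘ (r.permute π).pos) =
      π⁻¹ * Tuple.sort (siteKey ∘ r.pos) := by
    refine sort_eq_of_monotone hinj ?_
    have : (siteKey ∘ (r.permute π).pos) ∘ ⇑(π⁻¹ * Tuple.sort (siteKey ∘ r.pos)) =
        (siteKey ∘ r.pos) ∘ Tuple.sort (siteKey ∘ r.pos) := by
      funext i
      simp [Config.permute]
    rw [this]
    exact Tuple.monotone_sort _
  have hsum : ∑ k, bondIndex ((r.permute π).pos k) = ∑ k, bondIndex (r.pos k) :=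
    Equiv.sum_comp π fun k => bondIndex (r.pos k)
  rw [parity, parity, hsort, hsum, Perm.sign_mul, Perm.sign_inv, mul_assoc]

/-- A hop is a passage of an electron to a neighbouring bond, which does not change the order of
the electrons, followed by an exchange of two electrons. Both factors of the parity change sign. -/
theorem parity_eq_of_step {r s : Config Lx Ly N} (h : Step r s) : s.parity = r.parity := by
  classical
  obtain ⟨ℓ, v, a, c, hac, hop⟩ := step_iff.1 h
  obtain ⟨k, l, hk, hl, hc, hk', hl', ho⟩ := hop
  have hkl : k ≠ l := by
    rintro rfl
    exact hac.ne_vertex ℓ v (hk.symm.trans hl)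
  have hsort : Tuple.sort (siteKey ∘ s.pos) = swap k l * Tuple.sort (siteKey ∘ r.pos) := by
    refine sort_eq_of_monotone (siteKey_injective.comp s.pos_injective) ?_
    have hg : ∀ m, m ≠ k → s.pos (swap k l m) = r.pos m := by
      intro m hm
      by_cases hml : m = l
      · rw [hml, swap_apply_right, hk', hl]
      · rw [swap_apply_of_ne_of_ne hm hml, ho m hm hml]
    have hgk : s.pos (swap k l k) = c := by rw [swap_apply_left, hl']
    have hord : ∀ m n, siteKey (r.pos m) ≤ siteKey (r.pos n) →
        siteKey (s.pos (swap k l m)) ≤ siteKey (s.pos (swap k l n)) := by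
      intro m n hmn
      rcases eq_or_ne m n with rfl | hne
      · exact le_rfl
      have hlt : siteKey (r.pos m) < siteKey (r.pos n) :=
        lt_of_le_of_ne hmn fun h => hne (r.pos_injective (siteKey_injective h))
      by_cases hm : m = k
      · subst hm
        rw [hgk, hg n hne.symm]
        rw [hk] at hlt
        exact ((siteKey_lt_iff hac (fun h => hne (r.pos_injective (hk.trans h.symm)))
          (hc n)).2.1 hlt).le
      by_cases hn : n = k
      · subst hn
        rw [hgk, hg m hm]
        rw [hk] at hlt
        exact ((siteKey_lt_iff hac (fun h => hne (r.pos_injective (h.trans hk.symm)))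
          (hc m)).1.1 hlt).le
      · rw [hg m hm, hg n hn]
        exact hmn
    exact fun i j hij => hord _ _ (Tuple.monotone_sort (siteKey ∘ r.pos) hij)
  have hvert : bondIndex (ℓ.vertex v) = 0 := by
    obtain ⟨x, y, hxy⟩ := ℓ.exists_vertex_eq v
    rw [hxy, bondIndex]
  have hindex : bondIndex a = bondIndex c + 1 ∨ bondIndex c = bondIndex a + 1 := by
    cases ℓ <;> rcases hac with ⟨rfl, rfl⟩ | ⟨rfl, rfl⟩ <;> simp [Line.bond, bondIndex]
  have hsplit : ∀ t : Config Lx Ly N, ∑ m, bondIndex (t.pos m) =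
      bondIndex (t.pos k) + (bondIndex (t.pos l) +
        ∑ m ∈ (Finset.univ.erase k).erase l, bondIndex (t.pos m)) := fun t => by
    rw [Finset.add_sum_erase _ (fun m => bondIndex (t.pos m)) (by simp [hkl.symm]),
      Finset.add_sum_erase _ (fun m => bondIndex (t.pos m)) (Finset.mem_univ k)]
  have hrest : ∑ m ∈ (Finset.univ.erase k).erase l, bondIndex (s.pos m) =
      ∑ m ∈ (Finset.univ.erase k).erase l, bondIndex (r.pos m) := by
    refine Finset.sum_congr rfl fun m hm => ?_
    rw [Finset.mem_erase, Finset.mem_erase] at hm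
    rw [ho m hm.2.1 hm.1]
  rw [parity, parity, hsort, hsplit s, hsplit r, hrest, hk, hl, hk', hl', hvert, Perm.sign_mul,
    Perm.sign_swap hkl]
  rcases hindex with h | h <;> rw [h] <;> simp [pow_add]

theorem parity_eq_of_reach {r s : Config Lx Ly N} (h : Reach r s) : s.parity = r.parity := by
  induction h with
  | refl => rfl
  | tail _ h ih => rw [parity_eq_of_step h, ih]

theorem not_induces_of_sign_eq_neg_one (r : Config Lx Ly N) {π : Perm (Fin N)}
    (hπ : Perm.sign π = -1) : ¬ r.Induces π := by
  intro h
  have h1 := parity_eq_of_reach (show Reach r (r.permute π) from h)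
  rw [parity_permute, hπ, mul_eq_right] at h1
  exact absurd h1 (by decide)

end Config

end LiebLattice

theorem mainTheorem4 (Lx Ly N : ℕ) (r : LiebLattice.Config Lx Ly N)
    (hX : ∀ y : Fin Ly, 0 < r.X y ∧ r.X y < Lx)
    (hY : ∀ x : Fin Lx, 0 < r.Y x ∧ r.Y x < Ly) :
    r.EvenPermutationErgodic := by
  have hr : r.Mobile := LiebLattice.Config.mobile_of_count fun ℓ => by
    cases ℓ with
    | row y => exact hX y
    | col x => exact hY x
  exact fun π => ⟨fun hπ => LiebLattice.Config.induces_of_sign_eq_one hr hπ,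
    fun hπ => LiebLattice.Config.not_induces_of_sign_eq_neg_one r hπ⟩
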